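/- A linear MDP of dimension $D$ and horizon $H$ consists of a state space $\mathcal S$, a finite nonempty action set $\mathcal A$, a feature map $\phi:\mathcal S\times\mathcal A\to\mathbb R^D$ with $\|\phi(x,a)\|\le 1$, and, for each step $h\in\{1,\dots,H\}$, a $D$-tuple $\mu_h$ of signed measures on $\mathcal S$ and a vector $\theta_h\in\mathbb R^D$ such that $\mathbb P_h(\cdot\mid x,a)=\langle\phi(x,a),\mu_h(\cdot)\rangle$ is a probability distribution and $r_h(x,a)=\langle\phi(x,a),\theta_h\rangle\in[0,1]$ for all $(x,a)$, with $\int_{\mathcal S}\|\mu_h(dx)\|\le\sqrt D$ and $\|\theta_h\|\le\sqrt D$. A policy $\pi$ assigns to every step and state a distribution over actions; its value is the expected total reward of an episode of $H$ steps from a fixed initial state $s_0$, and $\pi$ is $\epsilon$-optimal if its value is within $\epsilon$ of the supremum of the values of all policies. A parallel algorithm with $P$ agents proceeds in episodes. In every episode it chooses, from its internal randomness and all trajectories collected in the previous episodes, an exploration policy for each agent (possibly a different one for each agent); each agent then independently plays one episode from $s_0$ with its own policy. After a possibly random number $\tau$ of episodes (a stopping time) it stops and outputs a policy $\hat\pi$.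 **Theorem.** There is a universal constant $c>0$ such that the following holds for all integers $d>1$, $H\ge 2$, $P>0$, $K$ with $KP\ge d^2$ and every $\epsilon>0$. Unless $KP\ge c\,(dH/\epsilon)^2$, there exist finite nonempty sets $\mathcal S$ and $\mathcal A$, a feature map $\phi:\mathcal S\times\mathcal A\to\mathbb R^{d+1}$, a reward function $r$ and an initial state $s_0\in\mathcal S$ such that, for every parallel algorithm with $P$ agents on these spaces (which may depend on $\phi$, $r$, $s_0$, $K$, $\epsilon$), there is a $(d+1)$-dimensional linear MDP $\mathcal M$ of horizon $H$ with feature map $\phi$ and reward function $r$ for which $$\Pr_{\mathcal M}\big[\tau>K\ \text{ or }\ \hat\pi\text{ is not }\epsilon\text{-optimal}\big]\ \ge\ 0.1 .$$ -/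

import Mathlib

open scoped BigOperators
open MeasureTheory

universe u

/-- A linear MDP of horizon `H` with finite state space `S`, finite action space `A` and known
feature map `φ : S × A → ℝ^D`.  Steps are indexed by `Fin H`.  A tuple of `D` signed measures on
the finite space `S` is given by its point masses `μ h x' ∈ ℝ^D`. -/
structure LinearMDP {D : ℕ} {S A : Type} [Fintype S] (H : ℕ)
    (φ : S → A → EuclideanSpace ℝ (Fin D)) where
  /-- the unknown measures `μ_h` -/
  μ : Fin H → S → EuclideanSpace ℝ (Fin D)
  /-- the reward parameters `θ_h` -/
  θ : Fin H → EuclideanSpace ℝ (Fin D)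
  /-- `⟨φ(x,a), μ_h(·)⟩` is a probability distribution on `S`. -/
  transition_nonneg : ∀ h x a x', 0 ≤ inner ℝ (φ x a) (μ h x')
  transition_sum : ∀ h x a, ∑ x', inner ℝ (φ x a) (μ h x') = 1
  /-- the rewards lie in `[0,1]` -/
  reward_mem : ∀ h x a, inner ℝ (φ x a) (θ h) ∈ Set.Icc (0 : ℝ) 1
  /-- normalization -/
  norm_φ_le : ∀ x a, ‖φ x a‖ ≤ 1
  norm_μ_le : ∀ h, ∑ x', ‖μ h x'‖ ≤ Real.sqrt D
  norm_θ_le : ∀ h, ‖θ h‖ ≤ Real.sqrt D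

/-- A (stochastic, Markov, step-dependent) policy: `π h x` is a distribution over actions. -/
abbrev Policy (H : ℕ) (S A : Type) [Fintype A] : Type :=
  Fin H → S → stdSimplex ℝ A

/-- A trajectory of one episode: the states `x_1, …, x_{H+1}` and the actions `a_1, …, a_H`. -/
abbrev Trajectory (H : ℕ) (S A : Type) : Type :=
  (Fin (H + 1) → S) × (Fin H → A)

/-- The data of `k` episodes of `P` agents. -/
abbrev History (P H : ℕ) (S A : Type) (k : ℕ) : Type :=
  Fin k → Fin P → Trajectory H S A

/-- The data of the first `k` out of `K` episodes. -/
def History.truncate {P H : ℕ} {S A : Type} {K k : ℕ} (hist : History P H S A K) (hk : k ≤ K) :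
    History P H S A k :=
  fun i => hist (Fin.castLE hk i)

namespace LinearMDP

variable {D H : ℕ} {S A : Type} [Fintype S] {φ : S → A → EuclideanSpace ℝ (Fin D)}

/-- The transition probability `ℙ_h(x' ∣ x, a)`. -/
noncomputable def transition (M : LinearMDP H φ) (h : Fin H) (x : S) (a : A) (x' : S) : ℝ :=
  inner ℝ (φ x a) (M.μ h x')

/-- The reward `r_h(x, a)`. -/
noncomputable def reward (M : LinearMDP H φ) (h : Fin H) (x : S) (a : A) : ℝ :=
  inner ℝ (φ x a) (M.θ h)

variable [Fintype A]

open Classical in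
/-- The probability of a trajectory when the policy `π` is played in `M` from the initial
state `s₀`. -/
noncomputable def trajProb (M : LinearMDP H φ) (s₀ : S) (π : Policy H S A)
    (t : Trajectory H S A) : ℝ :=
  (if t.1 0 = s₀ then 1 else 0) *
    ∏ h : Fin H, (π h (t.1 h.castSucc)).1 (t.2 h) *
      M.transition h (t.1 h.castSucc) (t.2 h) (t.1 h.succ)

open Classical in
/-- The value `V_1^π(s₀)`: the expected total reward of an episode started in `s₀`. -/
noncomputable def value (M : LinearMDP H φ) (s₀ : S) (π : Policy H S A) : ℝ :=
  ∑ t : Trajectory H S A, M.trajProb s₀ π t * ∑ h : Fin H, M.reward h (t.1 h.castSucc) (t.2 h)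

/-- The optimal value `V_1^*(s₀)`. -/
noncomputable def optimalValue (M : LinearMDP H φ) (s₀ : S) : ℝ :=
  ⨆ π : Policy H S A, M.value s₀ π

/-- The policy `π` is `ε`-optimal: its suboptimality at `s₀` is at most `ε`. -/
def IsEpsOptimal (M : LinearMDP H φ) (s₀ : S) (ε : ℝ) (π : Policy H S A) : Prop :=
  M.optimalValue s₀ - M.value s₀ π ≤ ε

end LinearMDP

/-- A parallel (possibly randomized and adaptive) algorithm with `P` agents for episodic problems
of horizon `H` on the state space `S` and action space `A`.  All internal randomness of the
algorithm is drawn from a random seed in an arbitrary probability space.  After `k` episodes, from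
the seed and from all the trajectories collected so far by all the agents, the algorithm decides
whether to stop; if it stops, it outputs a policy, and otherwise it assigns to every agent its own
exploration policy for the next episode.  (As `S` and `A` will be finite, measurability only
concerns the seed.) -/
structure ParallelAlgorithm (P H : ℕ) (S A : Type) [Fintype A] where
  Seed : Type u
  [seedMeasurableSpace : MeasurableSpace Seed]
  seedLaw : Measure Seed
  [isProbabilityMeasure : IsProbabilityMeasure seedLaw]
  explore : (k : ℕ) → Seed → History P H S A k → Fin P → Policy H S A
  halt : (k : ℕ) → Seed → History P H S A k → Prop
  output : (k : ℕ) → Seed → History P H S A k → Policy H S A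
  measurable_explore : ∀ k hist p, Measurable fun ω => explore k ω hist p
  measurableSet_halt : ∀ k hist, MeasurableSet {ω | halt k ω hist}
  measurable_output : ∀ k hist, Measurable fun ω => output k ω hist

attribute [instance] ParallelAlgorithm.seedMeasurableSpace ParallelAlgorithm.isProbabilityMeasure

namespace ParallelAlgorithm

variable {D P H : ℕ} {S A : Type} [Fintype S] [Fintype A]
  {φ : S → A → EuclideanSpace ℝ (Fin D)}

/-- The stopping time is `τ = k`: the algorithm stops after `k` episodes and not before. -/
def StopsAt (alg : ParallelAlgorithm.{u} P H S A) {K : ℕ} (ω : alg.Seed)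
    (hist : History P H S A K) (k : ℕ) (hk : k ≤ K) : Prop :=
  alg.halt k ω (hist.truncate hk) ∧
    ∀ (j : ℕ) (hj : j < k), ¬ alg.halt j ω (hist.truncate (hj.le.trans hk))

/-- The event `{τ > K or the output policy is not ε-optimal}`, which is determined by the seed and
the data of the first `K` episodes. -/
def Fails (alg : ParallelAlgorithm.{u} P H S A) (M : LinearMDP H φ) (s₀ : S) (ε : ℝ) {K : ℕ}
    (ω : alg.Seed) (hist : History P H S A K) : Prop :=
  (∀ (k : ℕ) (hk : k ≤ K), ¬ alg.StopsAt ω hist k hk) ∨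
    ∃ (k : ℕ) (hk : k ≤ K), alg.StopsAt ω hist k hk ∧
      ¬ M.IsEpsOptimal s₀ ε (alg.output k ω (hist.truncate hk))

/-- The conditional probability, given the seed, that the first `K` episodes in `M` produce the
data `hist`: in every episode each agent starts in `s₀` and plays its own exploration policy, and
given the seed and the past episodes the agents' trajectories are independent.  (Exploration is
continued formally after the algorithm has stopped; this does not affect the event `Fails`.) -/
noncomputable def histProb (alg : ParallelAlgorithm.{u} P H S A) (M : LinearMDP H φ) (s₀ : S)
    {K : ℕ} (ω : alg.Seed) (hist : History P H S A K) : ℝ :=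
  ∏ k : Fin K, ∏ p : Fin P,
    M.trajProb s₀ (alg.explore k ω (hist.truncate k.isLt.le) p) (hist k p)

open Classical in
/-- The probability, under `M`, of `{τ > K or the output policy is not ε-optimal}`. -/
noncomputable def failureProb (alg : ParallelAlgorithm.{u} P H S A) (M : LinearMDP H φ) (s₀ : S)
    (ε : ℝ) (K : ℕ) : ℝ :=
  ∫ ω, ∑ hist : History P H S A K with alg.Fails M s₀ ε ω hist, alg.histProb M s₀ ω hist
    ∂alg.seedLaw

end ParallelAlgorithm

/-!
The hard instances have two states, of reward `1` and `0`, and the sign vectors of length `m = d - 1`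
as actions.  At step `h`, whatever the state, action `a` leads to the rewarding state with
probability `1 / 2 + Δ ⟨a, v h⟩`, where the sign vectors `v h` are hidden and chosen separately
for every step.  The features need `m` coordinates for the action, one for the state (the reward) and one
constant, and the transition kernel mixes so strongly that the normalisation of the measures already
holds in dimension `3`; two absorbing states would force the measures to have total norm at
least `2 > √3`.

By `value_hardMDP` a policy loses `2 Δ` for every wrong sign it plays before the last step, so an
`ε`-optimal policy makes few mistakes.  Fix one sign `v k i` and compare `v` with its flip.  Only
step `k` of a trajectory carries information about it, and the law of the action played at step `k`
by a given policy does not depend on it; hence the mistake probabilities of one policy under the two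
parameters add up to `1` (`mistakeProb_add_flipSign`).  The Hellinger affinity of one trajectory
under the two parameters is at least `1 - 8 Δ²` (`le_sum_chainWeight_geomWeight`), and the
affinity is multiplicative along adaptively collected data, so for `Δ = 1 / (20 √(K P))` the laws of
the data of `K P` trajectories overlap in mass at least `12 / 25` (`le_sum_min_histProb`).
Averaged over `v`, every sign is therefore wrong with probability at least `6 / 25`.  Among the `n m`
relevant signs, `n = H - 1`, the output thus has, by the reverse Markov inequality, at least `n m / 10`
expected mistakes with probability at least `0.1` (`card_le_sum_fails`).  Some `v` does at least as
badly as the average.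
-/

/-! ### Weighted trajectories and sequentially collected data -/

theorem Fin.sum_cons_function {X : Type*} [Fintype X] {n : ℕ} (F : (Fin (n + 1) → X) → ℝ) :
    ∑ f, F f = ∑ x, ∑ g : Fin n → X, F (Fin.cons x g) := by
  rw [← Fintype.sum_prod_type']
  exact (Fintype.sum_equiv (Fin.consEquiv fun _ => X) _ _ fun _ => rfl).symm

section Chain

variable {S A : Type}

open Classical in
/-- The weight of a trajectory: the product of the step weights `w h x a x'` along it, restricted
to trajectories that start in `s`.  The weights need not be probabilities. -/
noncomputable def chainWeight {H : ℕ} (s : S) (w : Fin H → S → A → S → ℝ)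
    (t : Trajectory H S A) : ℝ :=
  (if t.1 0 = s then 1 else 0) * ∏ h : Fin H, w h (t.1 h.castSucc) (t.2 h) (t.1 h.succ)

theorem chainWeight_nonneg {H : ℕ} {s : S} {w : Fin H → S → A → S → ℝ}
    (hw : ∀ h x a x', 0 ≤ w h x a x') (t : Trajectory H S A) : 0 ≤ chainWeight s w t := by
  unfold chainWeight
  refine mul_nonneg ?_ (Finset.prod_nonneg fun h _ => hw _ _ _ _)
  split_ifs <;> norm_num

/-- A factor that depends on step `k` only can be absorbed into the `k`-th step weight. -/
theorem chainWeight_mul {H : ℕ} (s : S) (w : Fin H → S → A → S → ℝ) (k : Fin H)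
    (u : S → A → S → ℝ) (t : Trajectory H S A) :
    chainWeight s w t * u (t.1 k.castSucc) (t.2 k) (t.1 k.succ) =
      chainWeight s (Function.update w k fun x a x' => w k x a x' * u x a x') t := by
  unfold chainWeight
  rw [mul_assoc]
  congr 1
  rw [← Finset.mul_prod_erase _ _ (Finset.mem_univ k),
    ← Finset.mul_prod_erase _ _ (Finset.mem_univ k), Function.update_self, mul_right_comm]
  congr 1
  refine Finset.prod_congr rfl fun j hj => ?_
  rw [Function.update_of_ne (Finset.ne_of_mem_erase hj)]

variable [Fintype S] [Fintype A]

/-- Conditioning on the first step. -/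
theorem sum_chainWeight_succ {H : ℕ} (s : S) (w : Fin (H + 1) → S → A → S → ℝ) :
    ∑ t, chainWeight s w t =
      ∑ a, ∑ x', w 0 s a x' * ∑ t, chainWeight x' (fun h => w h.succ) t := by
  classical
  unfold chainWeight
  simp only [Fintype.sum_prod_type]
  rw [Fin.sum_cons_function]
  simp only [Fin.sum_cons_function (n := H) (X := A), Fin.prod_univ_succ, Fin.castSucc_zero,
    Fin.cons_zero, Fin.castSucc_succ, Fin.cons_succ, ite_mul, one_mul, zero_mul]
  rw [Finset.sum_eq_single s (fun b _ hb => by simp [hb]) (by simp)]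
  simp only [if_true]
  rw [Finset.sum_comm]
  refine Finset.sum_congr rfl fun a _ => ?_
  simp only [Finset.mul_sum]
  rw [Finset.sum_comm (s := (Finset.univ : Finset S))]
  refine Finset.sum_congr rfl fun xs _ => ?_
  rw [Finset.sum_comm (s := (Finset.univ : Finset S))]
  refine Finset.sum_congr rfl fun as _ => ?_
  rw [Finset.sum_eq_single (xs 0) (fun b _ hb => by simp [hb.symm]) (by simp)]
  simp

theorem sum_chainWeight_zero (s : S) (w : Fin 0 → S → A → S → ℝ) :
    ∑ t, chainWeight s w t = 1 := by
  classical
  unfold chainWeight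
  rw [Fintype.sum_prod_type, Fin.sum_cons_function]
  simp

theorem sum_chainWeight_eq_one {H : ℕ} (s : S) (w : Fin H → S → A → S → ℝ)
    (hw : ∀ h x, ∑ a, ∑ x', w h x a x' = 1) : ∑ t, chainWeight s w t = 1 := by
  induction H generalizing s with
  | zero => exact sum_chainWeight_zero s w
  | succ H ih =>
    rw [sum_chainWeight_succ]
    simp only [ih _ (fun h => w h.succ) fun h x => hw h.succ x, mul_one]
    exact hw 0 s

theorem prod_le_sum_chainWeight {H : ℕ} (s : S) (w : Fin H → S → A → S → ℝ) (ρ : Fin H → ℝ)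
    (hρ : ∀ h, 0 ≤ ρ h) (hw : ∀ h x a x', 0 ≤ w h x a x')
    (h : ∀ h x, ρ h ≤ ∑ a, ∑ x', w h x a x') : ∏ h, ρ h ≤ ∑ t, chainWeight s w t := by
  induction H generalizing s with
  | zero => rw [sum_chainWeight_zero]; simp
  | succ H ih =>
    rw [sum_chainWeight_succ, Fin.prod_univ_succ]
    have hp : 0 ≤ ∏ i : Fin H, ρ i.succ := Finset.prod_nonneg fun i _ => hρ _
    calc ρ 0 * ∏ i : Fin H, ρ i.succ
        ≤ (∑ a, ∑ x', w 0 s a x') * ∏ i : Fin H, ρ i.succ :=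
          mul_le_mul_of_nonneg_right (h 0 s) hp
      _ = ∑ a, ∑ x', w 0 s a x' * ∏ i : Fin H, ρ i.succ := by simp only [Finset.sum_mul]
      _ ≤ _ := Finset.sum_le_sum fun a _ => Finset.sum_le_sum fun x' _ =>
          mul_le_mul_of_nonneg_left
            (ih x' (fun h => w h.succ) (fun h => ρ h.succ) (fun _ => hρ _) (fun _ => hw _)
              fun _ => h _) (hw _ _ _ _)

/-- Two weight families that agree before step `k`, have the same row sums at step `k`, and are
stochastic afterwards have the same total mass. -/
theorem sum_chainWeight_congr {H : ℕ} (s : S) (w w' : Fin H → S → A → S → ℝ) (k : Fin H)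
    (hlt : ∀ j < k, w j = w' j)
    (hk : ∀ x, ∑ a, ∑ x', w k x a x' = ∑ a, ∑ x', w' k x a x')
    (hgt : ∀ j, k < j → ∀ x, ∑ a, ∑ x', w j x a x' = 1)
    (hgt' : ∀ j, k < j → ∀ x, ∑ a, ∑ x', w' j x a x' = 1) :
    ∑ t, chainWeight s w t = ∑ t, chainWeight s w' t := by
  induction H generalizing s with
  | zero => exact k.elim0
  | succ H ih =>
    rw [sum_chainWeight_succ, sum_chainWeight_succ]
    cases k using Fin.cases with
    | zero =>
      simp only [sum_chainWeight_eq_one _ (fun h => w h.succ)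
          fun h x => hgt h.succ (Fin.succ_pos h) x,
        sum_chainWeight_eq_one _ (fun h => w' h.succ)
          fun h x => hgt' h.succ (Fin.succ_pos h) x, mul_one]
      exact hk s
    | succ k =>
      rw [hlt 0 (Fin.succ_pos k)]
      refine Finset.sum_congr rfl fun a _ => Finset.sum_congr rfl fun x' _ => ?_
      rw [ih x' (fun h => w h.succ) (fun h => w' h.succ) k
        (fun j hj => hlt j.succ (Fin.succ_lt_succ_iff.2 hj)) hk
        (fun j hj => hgt j.succ (Fin.succ_lt_succ_iff.2 hj))
        fun j hj => hgt' j.succ (Fin.succ_lt_succ_iff.2 hj)]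

/-- The expectation of a function of step `k` depends on the law of that step only through the
one-step expectations given the current state, and does not depend on the later steps. -/
theorem sum_chainWeight_mul_congr {H : ℕ} (s : S) (w w' : Fin H → S → A → S → ℝ) (k : Fin H)
    (u u' : S → A → S → ℝ) (hlt : ∀ j < k, w j = w' j)
    (hk : ∀ x, ∑ a, ∑ x', w k x a x' * u x a x' = ∑ a, ∑ x', w' k x a x' * u' x a x')
    (hgt : ∀ j, k < j → ∀ x, ∑ a, ∑ x', w j x a x' = 1)
    (hgt' : ∀ j, k < j → ∀ x, ∑ a, ∑ x', w' j x a x' = 1) :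
    ∑ t : Trajectory H S A, chainWeight s w t * u (t.1 k.castSucc) (t.2 k) (t.1 k.succ) =
      ∑ t : Trajectory H S A,
        chainWeight s w' t * u' (t.1 k.castSucc) (t.2 k) (t.1 k.succ) := by
  simp only [chainWeight_mul]
  refine sum_chainWeight_congr s _ _ k (fun j hj => ?_) ?_ (fun j hj => ?_) fun j hj => ?_
  · rw [Function.update_of_ne hj.ne, Function.update_of_ne hj.ne, hlt j hj]
  · simpa only [Function.update_self] using hk
  · rw [Function.update_of_ne hj.ne']; exact hgt j hj
  · rw [Function.update_of_ne hj.ne']; exact hgt' j hj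

end Chain

section Sequential

variable {X : Type*}

theorem Fin.sum_snoc_function [Fintype X] {n : ℕ} (F : (Fin (n + 1) → X) → ℝ) :
    ∑ f, F f = ∑ g : Fin n → X, ∑ x, F (Fin.snoc g x) := by
  rw [Finset.sum_comm, ← Fintype.sum_prod_type']
  exact (Fintype.sum_equiv (Fin.snocEquiv fun _ => X) _ _ fun _ => rfl).symm

/-- Data of `n` rounds are generated sequentially: `f k` weighs the outcome of round `k` given the
first `k` outcomes. -/
theorem prod_sequential_snoc {n : ℕ} (f : (k : ℕ) → (Fin k → X) → X → ℝ) (g : Fin n → X)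
    (x : X) :
    (∏ k : Fin (n + 1), f k
        (fun i => (Fin.snoc g x : Fin (n + 1) → X) (Fin.castLE k.isLt.le i))
        ((Fin.snoc g x : Fin (n + 1) → X) k)) =
      (∏ k : Fin n, f k (fun i => g (Fin.castLE k.isLt.le i)) (g k)) * f n g x := by
  have key : ∀ (k : ℕ) (hk : k ≤ n) (hk' : k ≤ n + 1),
      (fun i : Fin k => (Fin.snoc g x : Fin (n + 1) → X) (Fin.castLE hk' i)) =
        fun i => g (Fin.castLE hk i) := by
    intro k hk hk'
    funext i
    have : Fin.castLE hk' i = (Fin.castLE hk i).castSucc := rfl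
    rw [this, Fin.snoc_castSucc]
  rw [Fin.prod_univ_castSucc]
  congr 1
  · refine Finset.prod_congr rfl fun k _ => ?_
    rw [Fin.snoc_castSucc]
    exact congrArg (fun h => f k h (g k)) (key k k.isLt.le _)
  · rw [Fin.snoc_last]
    exact congrArg (fun h => f n h x) (key n le_rfl _)

theorem sum_sequential_eq_one [Fintype X] (f : (k : ℕ) → (Fin k → X) → X → ℝ)
    (hf : ∀ k g, ∑ x, f k g x = 1) (n : ℕ) :
    ∑ g : Fin n → X, ∏ k : Fin n, f k (fun i => g (Fin.castLE k.isLt.le i)) (g k) = 1 := by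
  induction n with
  | zero => simp
  | succ n ih =>
    rw [Fin.sum_snoc_function]
    simp only [prod_sequential_snoc, ← Finset.mul_sum, hf, mul_one]
    exact ih

theorem pow_le_sum_sequential [Fintype X] (f : (k : ℕ) → (Fin k → X) → X → ℝ)
    (hf0 : ∀ k g x, 0 ≤ f k g x)
    {ρ : ℝ} (hρ : 0 ≤ ρ) (hf : ∀ k g, ρ ≤ ∑ x, f k g x) (n : ℕ) :
    ρ ^ n ≤
      ∑ g : Fin n → X, ∏ k : Fin n, f k (fun i => g (Fin.castLE k.isLt.le i)) (g k) := by
  induction n with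
  | zero => simp
  | succ n ih =>
    rw [Fin.sum_snoc_function]
    simp only [prod_sequential_snoc, ← Finset.mul_sum]
    rw [pow_succ]
    calc ρ ^ n * ρ ≤ (∑ g : Fin n → X, ∏ k : Fin n,
          f k (fun i => g (Fin.castLE k.isLt.le i)) (g k)) * ρ :=
          mul_le_mul_of_nonneg_right ih hρ
      _ ≤ _ := by
        rw [Finset.sum_mul]
        exact Finset.sum_le_sum fun g _ => mul_le_mul_of_nonneg_left (hf n g)
          (Finset.prod_nonneg fun k _ => hf0 _ _ _)

end Sequential

theorem sum_prod_agents {P : ℕ} {X : Type*} [Fintype X] (f : Fin P → X → ℝ) :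
    ∑ x : Fin P → X, ∏ p, f p (x p) = ∏ p, ∑ y, f p y := by
  classical
  rw [Finset.prod_univ_sum, Fintype.piFinset_univ]

/-- The overlap of two finite distributions is at least half the square of their Hellinger
affinity; `R` is the pointwise geometric mean of the two. -/
theorem sq_sum_le_two_mul_sum_min {ι : Type*} (s : Finset ι) (p q R : ι → ℝ)
    (hp : ∀ i, 0 ≤ p i) (hq : ∀ i, 0 ≤ q i) (hR : ∀ i, R i ^ 2 = p i * q i)
    (hp1 : ∑ i ∈ s, p i = 1) (hq1 : ∑ i ∈ s, q i = 1) :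
    (∑ i ∈ s, R i) ^ 2 ≤ 2 * ∑ i ∈ s, min (p i) (q i) := by
  have hmin : ∀ i, 0 ≤ min (p i) (q i) := fun i => le_min (hp i) (hq i)
  have h1 := Finset.sum_sq_le_sum_mul_sum_of_sq_le_mul s (r := R)
    (f := fun i => min (p i) (q i)) (g := fun i => max (p i) (q i)) (fun i _ => hmin i)
    (fun i _ => (hp i).trans (le_max_left _ _))
    (fun i _ => by rw [hR i, min_mul_max])
  have h2 : ∑ i ∈ s, max (p i) (q i) ≤ 2 := by
    calc ∑ i ∈ s, max (p i) (q i) ≤ ∑ i ∈ s, (p i + q i) :=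
          Finset.sum_le_sum fun i _ => max_le (le_add_of_nonneg_right (hq i))
            (le_add_of_nonneg_left (hp i))
      _ = 2 := by rw [Finset.sum_add_distrib, hp1, hq1]; norm_num
  have h3 : 0 ≤ ∑ i ∈ s, min (p i) (q i) := Finset.sum_nonneg fun i _ => hmin i
  nlinarith

/-! ### The hard instances and their values -/

/-- The sign `±1` encoded by a Boolean. -/
def boolSign (b : Bool) : ℝ := if b then 1 else -1

theorem boolSign_sq (b : Bool) : boolSign b ^ 2 = 1 := by cases b <;> simp [boolSign]

theorem abs_boolSign (b : Bool) : |boolSign b| = 1 := by cases b <;> simp [boolSign]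

theorem boolSign_mul (a b : Bool) : boolSign a * boolSign b = 1 - 2 * if a = b then 0 else 1 := by
  cases a <;> cases b <;> norm_num [boolSign]

section Instance

variable {m n : ℕ}

/-- The correlation `⟨a, v⟩` of two sign vectors. -/
def signInner (a v : Fin m → Bool) : ℝ := ∑ i, boolSign (a i) * boolSign (v i)

theorem abs_signInner_le (a v : Fin m → Bool) : |signInner a v| ≤ m := by
  calc |signInner a v| ≤ ∑ i, |boolSign (a i) * boolSign (v i)| := Finset.abs_sum_le_sum_abs _ _
    _ = m := by simp [abs_mul, abs_boolSign]

theorem signInner_eq (a v : Fin m → Bool) :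
    signInner a v = m - 2 * ∑ i, if a i = v i then (0 : ℝ) else 1 := by
  simp only [signInner, boolSign_mul, Finset.sum_sub_distrib, ← Finset.mul_sum]
  simp

/-- The probability that the next state is `x'` when `a` is played and `v` is the hidden sign
vector of the step: the state `true` is preferred with bias `Δ ⟨a, v⟩`. -/
noncomputable def nextProb (Δ : ℝ) (v a : Fin m → Bool) (x' : Bool) : ℝ :=
  1 / 2 + boolSign x' * (Δ * signInner a v)

theorem abs_mul_signInner_le {Δ : ℝ} (hΔ0 : 0 ≤ Δ) (hΔ : m * Δ ≤ 1 / 20) (v a : Fin m → Bool) :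
    |Δ * signInner a v| ≤ 1 / 20 := by
  rw [abs_mul, abs_of_nonneg hΔ0]
  nlinarith [abs_signInner_le a v]

theorem nextProb_ge {Δ : ℝ} (hΔ0 : 0 ≤ Δ) (hΔ : m * Δ ≤ 1 / 20) (v a : Fin m → Bool)
    (x' : Bool) : 1 / 4 ≤ nextProb Δ v a x' := by
  have := abs_le.1 (abs_mul_signInner_le hΔ0 hΔ v a)
  cases x' <;> simp only [nextProb, boolSign] <;> norm_num <;> linarith

theorem sum_nextProb (Δ : ℝ) (v a : Fin m → Bool) : ∑ x', nextProb Δ v a x' = 1 := by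
  simp [nextProb, boolSign]; ring

/-- The feature map of the hard instances.  The coordinates are a constant, the sign of the state
(which carries the reward), and a multiple of the sign vector `a` (which carries the
transitions). -/
noncomputable def hardFeature (m : ℕ) (x : Bool) (a : Fin m → Bool) :
    EuclideanSpace ℝ (Fin (m + 1 + 1)) :=
  WithLp.toLp 2 (Fin.cons (2 / 3) (Fin.cons (boolSign x / 2)
    fun i => boolSign (a i) / (2 * Real.sqrt m)))

theorem inner_toLp_cons_cons (m : ℕ) (a b c d : ℝ) (f g : Fin m → ℝ) :
    inner ℝ (WithLp.toLp 2 (Fin.cons a (Fin.cons b f) : Fin (m + 1 + 1) → ℝ))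
      (WithLp.toLp 2 (Fin.cons c (Fin.cons d g) : Fin (m + 1 + 1) → ℝ)) =
      a * c + b * d + ∑ i, f i * g i := by
  simp [PiLp.inner_apply, Fin.sum_univ_succ]
  simp only [mul_comm]
  ring

theorem norm_sq_toLp_cons_cons (m : ℕ) (a b : ℝ) (f : Fin m → ℝ) :
    ‖WithLp.toLp 2 (Fin.cons a (Fin.cons b f) : Fin (m + 1 + 1) → ℝ)‖ ^ 2 =
      a ^ 2 + b ^ 2 + ∑ i, f i ^ 2 := by
  rw [← real_inner_self_eq_norm_sq, inner_toLp_cons_cons]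
  simp only [sq]

/-- The point masses of the hard instances; they realise the transition probabilities `nextProb`. -/
noncomputable def hardMeasure (Δ : ℝ) (v : Fin m → Bool) (x' : Bool) :
    EuclideanSpace ℝ (Fin (m + 1 + 1)) :=
  WithLp.toLp 2 (Fin.cons (3 / 4) (Fin.cons 0
    fun i => boolSign x' * (2 * Real.sqrt m * Δ) * boolSign (v i)))

/-- The reward parameter: the reward is `1` in state `true` and `0` in state `false`. -/
noncomputable def hardTheta (m : ℕ) : EuclideanSpace ℝ (Fin (m + 1 + 1)) :=
  WithLp.toLp 2 (Fin.cons (3 / 4) (Fin.cons 1 fun _ => 0))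

theorem inner_hardFeature_hardMeasure (hm : 0 < m) (Δ : ℝ) (v a : Fin m → Bool) (x x' : Bool) :
    inner ℝ (hardFeature m x a) (hardMeasure Δ v x') = nextProb Δ v a x' := by
  have : Real.sqrt m ≠ 0 := (Real.sqrt_pos.2 (Nat.cast_pos.2 hm)).ne'
  rw [hardFeature, hardMeasure, inner_toLp_cons_cons, nextProb, signInner, Finset.mul_sum,
    Finset.mul_sum]
  congr 1
  · norm_num
  · refine Finset.sum_congr rfl fun i _ => ?_
    field_simp

theorem inner_hardFeature_hardTheta (x : Bool) (a : Fin m → Bool) :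
    inner ℝ (hardFeature m x a) (hardTheta m) = if x then 1 else 0 := by
  rw [hardFeature, hardTheta, inner_toLp_cons_cons]
  cases x <;> norm_num [boolSign]

theorem norm_hardFeature_le (hm : 0 < m) (x : Bool) (a : Fin m → Bool) :
    ‖hardFeature m x a‖ ≤ 1 := by
  have hm' : (0 : ℝ) < m := Nat.cast_pos.2 hm
  refine (sq_le_one_iff₀ (norm_nonneg _)).1 ?_
  rw [hardFeature, norm_sq_toLp_cons_cons]
  simp only [div_pow, boolSign_sq, mul_pow, Real.sq_sqrt hm'.le, Finset.sum_const,
    Finset.card_univ, Fintype.card_fin, nsmul_eq_mul]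
  have : (m : ℝ) * (1 / (2 ^ 2 * m)) = 1 / 4 := by field_simp; norm_num
  rw [this]; norm_num

theorem norm_hardMeasure_sq_le {Δ : ℝ} (hΔ0 : 0 ≤ Δ) (hΔ : m * Δ ≤ 1 / 20) (v : Fin m → Bool)
    (x' : Bool) : ‖hardMeasure Δ v x'‖ ^ 2 ≤ 3 / 4 := by
  rw [hardMeasure, norm_sq_toLp_cons_cons]
  simp only [boolSign_sq, mul_pow, Real.sq_sqrt (Nat.cast_nonneg m), Finset.sum_const,
    Finset.card_univ, Fintype.card_fin, nsmul_eq_mul]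
  nlinarith [mul_nonneg (Nat.cast_nonneg (α := ℝ) m) hΔ0]

theorem sum_norm_hardMeasure_le (hm : 0 < m) {Δ : ℝ} (hΔ0 : 0 ≤ Δ) (hΔ : m * Δ ≤ 1 / 20)
    (v : Fin m → Bool) :
    ∑ x', ‖hardMeasure Δ v x'‖ ≤ Real.sqrt ((m + 1 + 1 : ℕ) : ℝ) := by
  have hm' : (1 : ℝ) ≤ m := by exact_mod_cast hm
  refine Real.le_sqrt_of_sq_le ?_
  rw [Fintype.sum_bool]
  push_cast
  nlinarith [norm_hardMeasure_sq_le hΔ0 hΔ v true, norm_hardMeasure_sq_le hΔ0 hΔ v false,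
    sq_nonneg (‖hardMeasure Δ v true‖ - ‖hardMeasure Δ v false‖)]

theorem norm_hardTheta_le (hm : 0 < m) : ‖hardTheta m‖ ≤ Real.sqrt ((m + 1 + 1 : ℕ) : ℝ) := by
  have hm' : (1 : ℝ) ≤ m := by exact_mod_cast hm
  refine Real.le_sqrt_of_sq_le ?_
  rw [hardTheta, norm_sq_toLp_cons_cons]
  push_cast
  norm_num
  linarith

/-- The hard instance with hidden sign vectors `v h`, one for every step `h`. -/
noncomputable def hardMDP {H : ℕ} (hm : 0 < m) {Δ : ℝ} (hΔ0 : 0 ≤ Δ) (hΔ : m * Δ ≤ 1 / 20)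
    (v : Fin H → Fin m → Bool) : LinearMDP H (hardFeature m) where
  μ h x' := hardMeasure Δ (v h) x'
  θ _ := hardTheta m
  transition_nonneg h x a x' := by
    rw [inner_hardFeature_hardMeasure hm]
    linarith [nextProb_ge hΔ0 hΔ (v h) a x']
  transition_sum h x a := by
    simp only [inner_hardFeature_hardMeasure hm, sum_nextProb]
  reward_mem h x a := by
    rw [inner_hardFeature_hardTheta]
    split_ifs <;> norm_num
  norm_φ_le := norm_hardFeature_le hm
  norm_μ_le h := sum_norm_hardMeasure_le hm hΔ0 hΔ (v h)
  norm_θ_le _ := norm_hardTheta_le hm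

/-- The joint probability of the action `a` and the next state `x'` at state `x` and step `h`. -/
noncomputable def stepWeight {H : ℕ} (Δ : ℝ) (v : Fin H → Fin m → Bool)
    (π : Policy H Bool (Fin m → Bool)) (h : Fin H) (x : Bool) (a : Fin m → Bool)
    (x' : Bool) : ℝ :=
  (π h x).1 a * nextProb Δ (v h) a x'

theorem stepWeight_nonneg {H : ℕ} {Δ : ℝ} (hΔ0 : 0 ≤ Δ) (hΔ : m * Δ ≤ 1 / 20)
    (v : Fin H → Fin m → Bool) (π : Policy H Bool (Fin m → Bool)) (h : Fin H) (x : Bool)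
    (a : Fin m → Bool) (x' : Bool) : 0 ≤ stepWeight Δ v π h x a x' :=
  mul_nonneg ((π h x).2.1 a) (by linarith [nextProb_ge hΔ0 hΔ (v h) a x'])

theorem sum_stepWeight {H : ℕ} (Δ : ℝ) (v : Fin H → Fin m → Bool)
    (π : Policy H Bool (Fin m → Bool)) (h : Fin H) (x : Bool) :
    ∑ a, ∑ x', stepWeight Δ v π h x a x' = 1 := by
  simp only [stepWeight, ← Finset.mul_sum, sum_nextProb, mul_one]
  exact (π h x).2.2

theorem trajProb_hardMDP {H : ℕ} (hm : 0 < m) {Δ : ℝ} (hΔ0 : 0 ≤ Δ) (hΔ : m * Δ ≤ 1 / 20)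
    (v : Fin H → Fin m → Bool) (s : Bool) (π : Policy H Bool (Fin m → Bool)) :
    (hardMDP hm hΔ0 hΔ v).trajProb s π = chainWeight s (stepWeight Δ v π) := by
  funext t
  simp only [LinearMDP.trajProb, chainWeight, LinearMDP.transition, hardMDP,
    inner_hardFeature_hardMeasure hm, stepWeight]

theorem reward_hardMDP {H : ℕ} (hm : 0 < m) {Δ : ℝ} (hΔ0 : 0 ≤ Δ) (hΔ : m * Δ ≤ 1 / 20)
    (v : Fin H → Fin m → Bool) (h : Fin H) (x : Bool) (a : Fin m → Bool) :
    (hardMDP hm hΔ0 hΔ v).reward h x a = if x then 1 else 0 :=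
  inner_hardFeature_hardTheta x a

/-- The probability that at step `h` the policy plays an action whose `i`-th sign differs from the
hidden one. -/
noncomputable def mistakeProb {H : ℕ} (s : Bool) (Δ : ℝ) (v : Fin H → Fin m → Bool)
    (π : Policy H Bool (Fin m → Bool)) (h : Fin H) (i : Fin m) : ℝ :=
  ∑ t : Trajectory H Bool (Fin m → Bool),
    chainWeight s (stepWeight Δ v π) t * if t.2 h i = v h i then 0 else 1

theorem mistakeProb_nonneg {H : ℕ} (s : Bool) {Δ : ℝ} (hΔ0 : 0 ≤ Δ) (hΔ : m * Δ ≤ 1 / 20)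
    (v : Fin H → Fin m → Bool) (π : Policy H Bool (Fin m → Bool)) (h : Fin H) (i : Fin m) :
    0 ≤ mistakeProb s Δ v π h i :=
  Finset.sum_nonneg fun t _ => mul_nonneg
    (chainWeight_nonneg (stepWeight_nonneg hΔ0 hΔ v π) t) (by split_ifs <;> norm_num)

theorem mistakeProb_le_one {H : ℕ} (s : Bool) {Δ : ℝ} (hΔ0 : 0 ≤ Δ) (hΔ : m * Δ ≤ 1 / 20)
    (v : Fin H → Fin m → Bool) (π : Policy H Bool (Fin m → Bool)) (h : Fin H) (i : Fin m) :
    mistakeProb s Δ v π h i ≤ 1 := by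
  rw [← sum_chainWeight_eq_one s _ (sum_stepWeight Δ v π)]
  exact Finset.sum_le_sum fun t _ => mul_le_of_le_one_right
    (chainWeight_nonneg (stepWeight_nonneg hΔ0 hΔ v π) t) (by split_ifs <;> norm_num)

/-- The expected reward collected after step `k`. -/
theorem sum_chainWeight_mul_next {H : ℕ} (s : Bool) (Δ : ℝ) (v : Fin H → Fin m → Bool)
    (π : Policy H Bool (Fin m → Bool)) (k : Fin H) :
    ∑ t : Trajectory H Bool (Fin m → Bool),
        chainWeight s (stepWeight Δ v π) t * (if t.1 k.succ then 1 else 0) =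
      1 / 2 + Δ * m - 2 * Δ * ∑ i, mistakeProb s Δ v π k i := by
  rw [sum_chainWeight_mul_congr s _ (stepWeight Δ v π) k (fun _ _ x' => if x' then 1 else 0)
    (fun _ a _ => nextProb Δ (v k) a true) (fun _ _ => rfl) ?_
    (fun j _ => sum_stepWeight Δ v π j) fun j _ => sum_stepWeight Δ v π j]
  · simp only [mistakeProb]
    rw [Finset.sum_comm, Finset.mul_sum]
    have h1 := sum_chainWeight_eq_one s _ (sum_stepWeight Δ v π)
    have h2 : 1 / 2 + Δ * m = ∑ t : Trajectory H Bool (Fin m → Bool),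
        chainWeight s (stepWeight Δ v π) t * (1 / 2 + Δ * m) := by
      rw [← Finset.sum_mul, h1, one_mul]
    rw [h2, ← Finset.sum_sub_distrib]
    refine Finset.sum_congr rfl fun t _ => ?_
    rw [← Finset.mul_sum, nextProb, signInner_eq, boolSign, if_pos rfl]
    ring
  · intro x
    refine Finset.sum_congr rfl fun a _ => ?_
    rw [← Finset.sum_mul]
    simp only [stepWeight, ← Finset.mul_sum, sum_nextProb]
    simp

theorem value_hardMDP (hm : 0 < m) {Δ : ℝ} (hΔ0 : 0 ≤ Δ) (hΔ : m * Δ ≤ 1 / 20)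
    (v : Fin (n + 1) → Fin m → Bool) (π : Policy (n + 1) Bool (Fin m → Bool)) :
    (hardMDP hm hΔ0 hΔ v).value true π =
      1 + n * (1 / 2 + Δ * m) -
        2 * Δ * ∑ k : Fin n, ∑ i, mistakeProb true Δ v π k.castSucc i := by
  simp only [LinearMDP.value, trajProb_hardMDP, reward_hardMDP, Fin.sum_univ_succ, mul_add,
    Finset.sum_add_distrib, Finset.mul_sum]
  have h0 : ∑ t : Trajectory (n + 1) Bool (Fin m → Bool),
      chainWeight true (stepWeight Δ v π) t *
        (if t.1 (Fin.castSucc 0) then (1 : ℝ) else 0) = 1 := by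
    refine Eq.trans (Finset.sum_congr rfl fun t _ => ?_)
      (sum_chainWeight_eq_one true _ (sum_stepWeight Δ v π))
    unfold chainWeight
    by_cases h : t.1 0 = true <;> simp [h]
  rw [h0, Finset.sum_comm]
  have hk : ∀ k : Fin n, ∑ t : Trajectory (n + 1) Bool (Fin m → Bool),
      chainWeight true (stepWeight Δ v π) t *
        (if t.1 k.succ.castSucc then (1 : ℝ) else 0) = _ :=
    fun k => sum_chainWeight_mul_next true Δ v π k.castSucc
  simp only [hk, Finset.sum_sub_distrib, Finset.sum_const, Finset.card_univ, Fintype.card_fin,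
    nsmul_eq_mul, Finset.mul_sum]
  ring

/-- The policy that plays the hidden sign vector of every step. -/
noncomputable def oraclePolicy {H : ℕ} (v : Fin H → Fin m → Bool) :
    Policy H Bool (Fin m → Bool) :=
  fun h _ => ⟨Pi.single (v h) 1, single_mem_stdSimplex ℝ (v h)⟩

theorem mistakeProb_oraclePolicy {H : ℕ} (s : Bool) (Δ : ℝ) (v : Fin H → Fin m → Bool)
    (h : Fin H) (i : Fin m) : mistakeProb s Δ v (oraclePolicy v) h i = 0 := by
  refine Finset.sum_eq_zero fun t _ => ?_
  split_ifs with hi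
  · simp
  · rw [chainWeight, Finset.prod_eq_zero (Finset.mem_univ h), mul_zero, zero_mul]
    have : t.2 h ≠ v h := fun h' => hi (by rw [h'])
    simp [stepWeight, oraclePolicy, Pi.single_eq_of_ne this]

/-- The suboptimality is at least `2 Δ` times the expected number of wrong signs played before the
last step. -/
theorem not_isEpsOptimal_hardMDP (hm : 0 < m) {Δ : ℝ} (hΔ0 : 0 ≤ Δ) (hΔ : m * Δ ≤ 1 / 20)
    (v : Fin (n + 1) → Fin m → Bool) (π : Policy (n + 1) Bool (Fin m → Bool)) {ε : ℝ}
    (h : ε < 2 * Δ * ∑ k : Fin n, ∑ i, mistakeProb true Δ v π k.castSucc i) :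
    ¬ (hardMDP hm hΔ0 hΔ v).IsEpsOptimal true ε π := by
  have hbdd : BddAbove (Set.range fun π => (hardMDP hm hΔ0 hΔ v).value true π) := by
    refine ⟨1 + n * (1 / 2 + Δ * m), ?_⟩
    rintro _ ⟨π, rfl⟩
    simp only [value_hardMDP]
    have : 0 ≤ ∑ k : Fin n, ∑ i, mistakeProb true Δ v π k.castSucc i :=
      Finset.sum_nonneg fun k _ => Finset.sum_nonneg fun i _ => mistakeProb_nonneg _ hΔ0 hΔ _ _ _ _
    nlinarith
  have hle := le_ciSup hbdd (oraclePolicy v)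
  simp only [value_hardMDP hm hΔ0 hΔ v (oraclePolicy v), mistakeProb_oraclePolicy,
    Finset.sum_const_zero, mul_zero, sub_zero] at hle
  rw [LinearMDP.IsEpsOptimal, LinearMDP.optimalValue, value_hardMDP, not_le]
  linarith

end Instance

/-! ### Indistinguishability of neighbouring parameters -/

section Flip

variable {m H : ℕ}

/-- The hidden parameter with the `i`-th sign of step `k` reversed. -/
def flipSign (k : Fin H) (i : Fin m) (v : Fin H → Fin m → Bool) : Fin H → Fin m → Bool :=
  Function.update v k (Function.update (v k) i (!v k i))

theorem flipSign_involutive (k : Fin H) (i : Fin m) : Function.Involutive (flipSign k i) := by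
  intro v
  simp [flipSign]

theorem flipSign_apply_of_ne {k h : Fin H} (hne : h ≠ k) (i : Fin m) (v : Fin H → Fin m → Bool) :
    flipSign k i v h = v h := by
  simp [flipSign, hne]

theorem flipSign_apply_self (k : Fin H) (i : Fin m) (v : Fin H → Fin m → Bool) :
    flipSign k i v k i = !v k i := by
  simp [flipSign]

/-- The sign `v k i` has no influence on the law of the action played at step `k`, so that a policy
cannot be right with probability more than `1 / 2` for both values of this sign. -/
theorem mistakeProb_add_flipSign (s : Bool) (Δ : ℝ) (v : Fin H → Fin m → Bool)
    (π : Policy H Bool (Fin m → Bool)) (k : Fin H) (i : Fin m) :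
    mistakeProb s Δ v π k i + mistakeProb s Δ (flipSign k i v) π k i = 1 := by
  have h1 : mistakeProb s Δ (flipSign k i v) π k i =
      ∑ t : Trajectory H Bool (Fin m → Bool),
        chainWeight s (stepWeight Δ v π) t * if t.2 k i = !v k i then 0 else 1 := by
    rw [mistakeProb, flipSign_apply_self]
    refine sum_chainWeight_mul_congr s _ _ k (fun _ a _ => if a i = !v k i then 0 else 1)
      (fun _ a _ => if a i = !v k i then 0 else 1) (fun j hj => ?_) (fun x => ?_)
      (fun j _ => sum_stepWeight Δ _ π j) fun j _ => sum_stepWeight Δ _ π j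
    · funext x a x'
      rw [stepWeight, stepWeight, flipSign_apply_of_ne hj.ne]
    · simp only [← Finset.sum_mul, stepWeight, ← Finset.mul_sum, sum_nextProb]
  rw [h1, mistakeProb, ← Finset.sum_add_distrib]
  refine Eq.trans (Finset.sum_congr rfl fun t _ => ?_)
    (sum_chainWeight_eq_one s _ (sum_stepWeight Δ v π))
  cases t.2 k i <;> cases v k i <;> simp

theorem abs_nextProb_sub_flipSign {Δ : ℝ} (hΔ0 : 0 ≤ Δ) (k : Fin H) (i : Fin m)
    (v : Fin H → Fin m → Bool) (a : Fin m → Bool) (x' : Bool) :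
    |nextProb Δ (v k) a x' - nextProb Δ (flipSign k i v k) a x'| ≤ 2 * Δ := by
  have h : signInner a (v k) - signInner a (flipSign k i v k) =
      2 * (boolSign (a i) * boolSign (v k i)) := by
    rw [signInner, signInner, ← Finset.sum_sub_distrib, Finset.sum_eq_single i]
    · rw [flipSign_apply_self]
      cases a i <;> cases v k i <;> norm_num [boolSign]
    · intro j _ hj
      simp [flipSign, hj]
    · simp
  have : nextProb Δ (v k) a x' - nextProb Δ (flipSign k i v k) a x' =
      2 * Δ * (boolSign x' * (boolSign (a i) * boolSign (v k i))) := by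
    rw [nextProb, nextProb]
    linear_combination boolSign x' * Δ * h
  rw [this]
  simp [abs_mul, abs_boolSign, abs_of_nonneg hΔ0]

/-- The geometric mean is within a quadratic error of the arithmetic mean. -/
theorem half_add_sub_le_sqrt_mul {p q Δ : ℝ} (hp : 1 / 4 ≤ p) (hq : 1 / 4 ≤ q) (hΔ0 : 0 ≤ Δ)
    (hΔ : Δ ≤ 1 / 20) (h : |p - q| ≤ 2 * Δ) : (p + q) / 2 - 4 * Δ ^ 2 ≤ Real.sqrt (p * q) := by
  have h1 : (p - q) ^ 2 ≤ 4 * Δ ^ 2 := by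
    have := sq_le_sq' (abs_le.1 h).1 (abs_le.1 h).2
    nlinarith
  have h2 : Δ ^ 2 ≤ 1 / 400 := by nlinarith
  refine Real.le_sqrt_of_sq_le ?_
  nlinarith [mul_nonneg (sq_nonneg Δ) (by linarith : (0 : ℝ) ≤ p + q - 1 / 2),
    mul_nonneg (sq_nonneg Δ) (by linarith : (0 : ℝ) ≤ 1 / 400 - Δ ^ 2)]

/-- The pointwise geometric mean of the step weights under two hidden parameters. -/
noncomputable def geomWeight (Δ : ℝ) (v v' : Fin H → Fin m → Bool)
    (π : Policy H Bool (Fin m → Bool)) (h : Fin H) (x : Bool) (a : Fin m → Bool)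
    (x' : Bool) : ℝ :=
  (π h x).1 a * Real.sqrt (nextProb Δ (v h) a x' * nextProb Δ (v' h) a x')

theorem geomWeight_nonneg (Δ : ℝ) (v v' : Fin H → Fin m → Bool)
    (π : Policy H Bool (Fin m → Bool)) (h : Fin H) (x : Bool) (a : Fin m → Bool)
    (x' : Bool) : 0 ≤ geomWeight Δ v v' π h x a x' :=
  mul_nonneg ((π h x).2.1 a) (Real.sqrt_nonneg _)

theorem chainWeight_geomWeight_sq {Δ : ℝ} (hΔ0 : 0 ≤ Δ) (hΔ : m * Δ ≤ 1 / 20)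
    (s : Bool) (v v' : Fin H → Fin m → Bool) (π : Policy H Bool (Fin m → Bool))
    (t : Trajectory H Bool (Fin m → Bool)) :
    chainWeight s (geomWeight Δ v v' π) t ^ 2 =
      chainWeight s (stepWeight Δ v π) t * chainWeight s (stepWeight Δ v' π) t := by
  simp only [chainWeight]
  rw [mul_pow, ← Finset.prod_pow, mul_mul_mul_comm, ← Finset.prod_mul_distrib]
  congr 1
  · split_ifs <;> norm_num
  · refine Finset.prod_congr rfl fun h _ => ?_
    have h1 := nextProb_ge hΔ0 hΔ (v h) (t.2 h) (t.1 h.succ)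
    have h2 := nextProb_ge hΔ0 hΔ (v' h) (t.2 h) (t.1 h.succ)
    rw [geomWeight, mul_pow, Real.sq_sqrt (mul_nonneg (by linarith) (by linarith)), stepWeight,
      stepWeight]
    ring

/-- The Hellinger affinity of the trajectory laws for two parameters that differ in one sign. -/
theorem le_sum_chainWeight_geomWeight {Δ : ℝ} (hm : 0 < m) (hΔ0 : 0 ≤ Δ) (hΔ : m * Δ ≤ 1 / 20)
    (s : Bool) (v : Fin H → Fin m → Bool) (k : Fin H) (i : Fin m)
    (π : Policy H Bool (Fin m → Bool)) :
    1 - 8 * Δ ^ 2 ≤ ∑ t, chainWeight s (geomWeight Δ v (flipSign k i v) π) t := by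
  have hΔ1 : Δ ≤ 1 / 20 := by
    have : (1 : ℝ) ≤ m := by exact_mod_cast hm
    nlinarith
  have hpos : 0 ≤ 1 - 8 * Δ ^ 2 := by nlinarith
  have := prod_le_sum_chainWeight s (geomWeight Δ v (flipSign k i v) π)
    (fun h => if h = k then 1 - 8 * Δ ^ 2 else 1) (fun h => by split_ifs <;> linarith)
    (geomWeight_nonneg _ _ _ _) fun h x => ?_
  · simpa using this
  have hsum : ∑ a, (π h x).1 a = 1 := (π h x).2.2
  simp only [geomWeight, ← Finset.mul_sum]
  have hρ : ∀ c : ℝ, c = ∑ a, (π h x).1 a * c := fun c => by rw [← Finset.sum_mul, hsum, one_mul]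
  rw [hρ (ite _ _ _)]
  refine Finset.sum_le_sum fun a _ => ?_
  refine mul_le_mul_of_nonneg_left ?_ ((π h x).2.1 a)
  have hone := sum_nextProb Δ (v h) a
  split_ifs with hk
  · subst hk
    have hone' := sum_nextProb Δ (flipSign h i v h) a
    rw [Fintype.sum_bool] at hone hone' ⊢
    have key := fun x' => half_add_sub_le_sqrt_mul (nextProb_ge hΔ0 hΔ (v h) a x')
      (nextProb_ge hΔ0 hΔ (flipSign h i v h) a x') hΔ0 hΔ1
      (abs_nextProb_sub_flipSign hΔ0 h i v a x')
    linarith [key true, key false]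
  · rw [flipSign_apply_of_ne hk]
    refine hone.ge.trans (Finset.sum_le_sum fun x' _ => ?_)
    rw [Real.sqrt_mul_self (by linarith [nextProb_ge hΔ0 hΔ (v h) a x'])]

end Flip

section Algorithm

variable {m H P K : ℕ}

theorem histProb_nonneg (alg : ParallelAlgorithm.{u} P H Bool (Fin m → Bool)) (hm : 0 < m)
    {Δ : ℝ} (hΔ0 : 0 ≤ Δ) (hΔ : m * Δ ≤ 1 / 20) (v : Fin H → Fin m → Bool) (s : Bool)
    (ω : alg.Seed) (hist : History P H Bool (Fin m → Bool) K) :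
    0 ≤ alg.histProb (hardMDP hm hΔ0 hΔ v) s ω hist := by
  refine Finset.prod_nonneg fun k _ => Finset.prod_nonneg fun p _ => ?_
  rw [trajProb_hardMDP]
  exact chainWeight_nonneg (stepWeight_nonneg hΔ0 hΔ v _) _

theorem sum_histProb (alg : ParallelAlgorithm.{u} P H Bool (Fin m → Bool)) (hm : 0 < m)
    {Δ : ℝ} (hΔ0 : 0 ≤ Δ) (hΔ : m * Δ ≤ 1 / 20) (v : Fin H → Fin m → Bool) (s : Bool)
    (ω : alg.Seed) :
    ∑ hist : History P H Bool (Fin m → Bool) K,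
      alg.histProb (hardMDP hm hΔ0 hΔ v) s ω hist = 1 := by
  refine sum_sequential_eq_one (X := Fin P → Trajectory H Bool (Fin m → Bool))
    (fun k g x => ∏ p, (hardMDP hm hΔ0 hΔ v).trajProb s (alg.explore k ω g p) (x p))
    (fun k g => ?_) K
  rw [sum_prod_agents]
  refine Finset.prod_eq_one fun p _ => ?_
  rw [trajProb_hardMDP]
  exact sum_chainWeight_eq_one s _ (sum_stepWeight Δ v _)

/-- The data of `K * P` trajectories overlap substantially for two parameters that differ in one
sign: the Hellinger affinity is multiplicative along the adaptively collected data. -/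
theorem le_sum_min_histProb (alg : ParallelAlgorithm.{u} P H Bool (Fin m → Bool)) (hm : 0 < m)
    {Δ : ℝ} (hΔ0 : 0 ≤ Δ) (hΔ : m * Δ ≤ 1 / 20) (hT : 8 * Δ ^ 2 * (K * P : ℕ) ≤ 1 / 50)
    (v : Fin H → Fin m → Bool) (k : Fin H) (i : Fin m) (s : Bool) (ω : alg.Seed) :
    (12 : ℝ) / 25 ≤ ∑ hist : History P H Bool (Fin m → Bool) K,
      min (alg.histProb (hardMDP hm hΔ0 hΔ v) s ω hist)
        (alg.histProb (hardMDP hm hΔ0 hΔ (flipSign k i v)) s ω hist) := by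
  have hpos : 0 ≤ 1 - 8 * Δ ^ 2 := by
    have : (1 : ℝ) ≤ m := by exact_mod_cast hm
    nlinarith
  let f : (j : ℕ) → (Fin j → Fin P → Trajectory H Bool (Fin m → Bool)) →
      (Fin P → Trajectory H Bool (Fin m → Bool)) → ℝ := fun j g x =>
    ∏ p, chainWeight s (geomWeight Δ v (flipSign k i v) (alg.explore j ω g p)) (x p)
  let R : History P H Bool (Fin m → Bool) K → ℝ := fun hist =>
    ∏ j : Fin K, f j (fun l => hist (Fin.castLE j.isLt.le l)) (hist j)
  have haff : 49 / 50 ≤ ∑ hist, R hist := by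
    have h1 := pow_le_sum_sequential f
      (fun j g x => Finset.prod_nonneg fun p _ => chainWeight_nonneg (geomWeight_nonneg _ _ _ _) _)
      (pow_nonneg hpos P) (fun j g => ?_) K
    · refine le_trans ?_ h1
      rw [← pow_mul]
      have h2 := one_add_mul_le_pow (a := -(8 * Δ ^ 2)) (by linarith) (P * K)
      rw [← sub_eq_add_neg] at h2
      refine le_trans ?_ h2
      push_cast at hT ⊢
      linarith
    · rw [sum_prod_agents]
      calc (1 - 8 * Δ ^ 2) ^ P = ∏ _p : Fin P, (1 - 8 * Δ ^ 2) := by simp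
        _ ≤ _ := Finset.prod_le_prod (fun _ _ => hpos)
          fun p _ => le_sum_chainWeight_geomWeight hm hΔ0 hΔ s v k i _
  have hsq := sq_sum_le_two_mul_sum_min Finset.univ
    (fun hist => alg.histProb (K := K) (hardMDP hm hΔ0 hΔ v) s ω hist)
    (fun hist => alg.histProb (hardMDP hm hΔ0 hΔ (flipSign k i v)) s ω hist) R
    (histProb_nonneg alg hm hΔ0 hΔ _ s ω) (histProb_nonneg alg hm hΔ0 hΔ _ s ω)
    (fun hist => ?_) (sum_histProb alg hm hΔ0 hΔ _ s ω) (sum_histProb alg hm hΔ0 hΔ _ s ω)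
  · nlinarith
  · simp only [R, f, ParallelAlgorithm.histProb, trajProb_hardMDP, ← Finset.prod_pow,
      ← Finset.prod_mul_distrib, chainWeight_geomWeight_sq hΔ0 hΔ]
    rfl

/-- Averaged over the hidden parameter, any estimator `ψ` gets each sign wrong with probability at
least `6 / 25`. -/
theorem le_sum_histProb_mul_mistakeProb
    (alg : ParallelAlgorithm.{u} P H Bool (Fin m → Bool)) (hm : 0 < m)
    {Δ : ℝ} (hΔ0 : 0 ≤ Δ) (hΔ : m * Δ ≤ 1 / 20) (hT : 8 * Δ ^ 2 * (K * P : ℕ) ≤ 1 / 50)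
    (k : Fin H) (i : Fin m) (s : Bool) (ω : alg.Seed)
    (ψ : History P H Bool (Fin m → Bool) K → Policy H Bool (Fin m → Bool)) :
    (6 : ℝ) / 25 * Fintype.card (Fin H → Fin m → Bool) ≤
      ∑ v : Fin H → Fin m → Bool, ∑ hist,
        alg.histProb (hardMDP hm hΔ0 hΔ v) s ω hist * mistakeProb s Δ v (ψ hist) k i := by
  set F : (Fin H → Fin m → Bool) → ℝ := fun v => ∑ hist,
    alg.histProb (hardMDP hm hΔ0 hΔ v) s ω hist * mistakeProb s Δ v (ψ hist) k i with hF
  -- Pair every `v` with its flip.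
  have hflip : ∑ v, F (flipSign k i v) = ∑ v, F v :=
    Equiv.sum_comp (flipSign_involutive k i).toPerm F
  have hpair : ∀ v, (12 : ℝ) / 25 ≤ F v + F (flipSign k i v) := by
    intro v
    refine (le_sum_min_histProb (K := K) alg hm hΔ0 hΔ hT v k i s ω).trans ?_
    rw [hF, ← Finset.sum_add_distrib]
    refine Finset.sum_le_sum fun hist _ => ?_
    have h1 := mistakeProb_add_flipSign s Δ v (ψ hist) k i
    have h2 := mistakeProb_nonneg s hΔ0 hΔ v (ψ hist) k i
    have h3 := mistakeProb_nonneg s hΔ0 hΔ (flipSign k i v) (ψ hist) k i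
    set p := alg.histProb (hardMDP hm hΔ0 hΔ v) s ω hist
    set q := alg.histProb (hardMDP hm hΔ0 hΔ (flipSign k i v)) s ω hist
    calc min p q = min p q * mistakeProb s Δ v (ψ hist) k i +
          min p q * mistakeProb s Δ (flipSign k i v) (ψ hist) k i := by rw [← mul_add, h1, mul_one]
      _ ≤ _ := add_le_add (mul_le_mul_of_nonneg_right (min_le_left _ _) h2)
          (mul_le_mul_of_nonneg_right (min_le_right _ _) h3)
  have hsum : ∑ _v : Fin H → Fin m → Bool, (12 : ℝ) / 25 ≤ ∑ v, (F v + F (flipSign k i v)) :=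
    Finset.sum_le_sum fun v _ => hpair v
  rw [Finset.sum_add_distrib, hflip, Finset.sum_const, Finset.card_univ, nsmul_eq_mul] at hsum
  linarith

end Algorithm

/-! ### The failure probability -/

section Failure

variable {m n P K : ℕ}

open Classical in
/-- The output of the algorithm if it stops within `K` episodes; otherwise an arbitrary policy. -/
noncomputable def finalOutput {H : ℕ} {S A : Type} [Fintype A]
    (alg : ParallelAlgorithm.{u} P H S A) (ω : alg.Seed) (hist : History P H S A K) :
    Policy H S A :=
  if h : ∃ (k : ℕ) (hk : k ≤ K), alg.StopsAt ω hist k hk then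
    alg.output h.choose ω (hist.truncate h.choose_spec.choose)
  else alg.output K ω hist

theorem fails_of_not_isEpsOptimal_finalOutput {D H : ℕ} {S A : Type} [Fintype S] [Fintype A]
    {φ : S → A → EuclideanSpace ℝ (Fin D)} (alg : ParallelAlgorithm.{u} P H S A)
    (M : LinearMDP H φ) (s : S) (ε : ℝ) (ω : alg.Seed) (hist : History P H S A K)
    (h : ¬ M.IsEpsOptimal s ε (finalOutput alg ω hist)) : alg.Fails M s ε ω hist := by
  by_cases hs : ∃ (k : ℕ) (hk : k ≤ K), alg.StopsAt ω hist k hk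
  · refine Or.inr ⟨hs.choose, hs.choose_spec.choose, hs.choose_spec.choose_spec, ?_⟩
    rwa [finalOutput, dif_pos hs] at h
  · exact Or.inl fun k hk hst => hs ⟨k, hk, hst⟩

open Classical in
/-- Averaged over the hidden parameter, the failure probability given the seed is at least `0.1`. -/
theorem card_le_sum_fails (alg : ParallelAlgorithm.{u} P (n + 1) Bool (Fin m → Bool))
    (hm : 0 < m) (hn : 0 < n) {Δ ε : ℝ} (hΔ0 : 0 ≤ Δ) (hΔ : m * Δ ≤ 1 / 20)
    (hT : 8 * Δ ^ 2 * (K * P : ℕ) ≤ 1 / 50) (hε : ε < 2 * Δ * (n * m / 10)) (ω : alg.Seed) :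
    0.1 * (Fintype.card (Fin (n + 1) → Fin m → Bool) : ℝ) ≤
      ∑ v : Fin (n + 1) → Fin m → Bool,
        ∑ hist : History P (n + 1) Bool (Fin m → Bool) K with
          alg.Fails (hardMDP hm hΔ0 hΔ v) true ε ω hist,
          alg.histProb (hardMDP hm hΔ0 hΔ v) true ω hist := by
  have hnm : (0 : ℝ) < n * m := by positivity
  set N : (Fin (n + 1) → Fin m → Bool) → History P (n + 1) Bool (Fin m → Bool) K → ℝ :=
    fun v hist => ∑ k : Fin n, ∑ i, mistakeProb true Δ v (finalOutput alg ω hist) k.castSucc i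
    with hN
  have hlow : n * m * ((6 : ℝ) / 25 * Fintype.card (Fin (n + 1) → Fin m → Bool)) ≤
      ∑ v : Fin (n + 1) → Fin m → Bool, ∑ hist,
        alg.histProb (hardMDP hm hΔ0 hΔ v) true ω hist * N v hist := by
    calc n * m * ((6 : ℝ) / 25 * Fintype.card (Fin (n + 1) → Fin m → Bool))
        = ∑ _k : Fin n, ∑ _i : Fin m,
            (6 : ℝ) / 25 * Fintype.card (Fin (n + 1) → Fin m → Bool) := by
          simp only [Finset.sum_const, Finset.card_univ, Fintype.card_fin, nsmul_eq_mul]; ring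
      _ ≤ _ := Finset.sum_le_sum fun k _ => Finset.sum_le_sum fun i _ =>
          le_sum_histProb_mul_mistakeProb alg hm hΔ0 hΔ hT k.castSucc i true ω
            (finalOutput (K := K) alg ω)
      _ = _ := by
          simp only [hN, Finset.mul_sum]
          refine (Finset.sum_congr rfl fun k _ => Finset.sum_comm).trans
            (Finset.sum_comm.trans (Finset.sum_congr rfl fun v _ => ?_))
          exact (Finset.sum_congr rfl fun k _ => Finset.sum_comm).trans Finset.sum_comm
  -- A run that does not fail has at most `n m / 10` expected mistakes, any other at most `n m`.
  have hup : ∀ v : Fin (n + 1) → Fin m → Bool,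
      ∑ hist, alg.histProb (hardMDP hm hΔ0 hΔ v) true ω hist * N v hist ≤
        n * m / 10 + 9 * (n * m) / 10 *
          ∑ hist : History P (n + 1) Bool (Fin m → Bool) K with
            alg.Fails (hardMDP hm hΔ0 hΔ v) true ε ω hist,
            alg.histProb (hardMDP hm hΔ0 hΔ v) true ω hist := by
    intro v
    have h1 := sum_histProb (K := K) alg hm hΔ0 hΔ v true ω
    have h2 : (n * m / 10 : ℝ) = ∑ hist : History P (n + 1) Bool (Fin m → Bool) K,
        alg.histProb (hardMDP hm hΔ0 hΔ v) true ω hist * (n * m / 10) := by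
      rw [← Finset.sum_mul, h1, one_mul]
    rw [Finset.sum_filter, Finset.mul_sum, h2, ← Finset.sum_add_distrib]
    refine Finset.sum_le_sum fun hist _ => ?_
    have hL := histProb_nonneg alg hm hΔ0 hΔ v true ω hist
    split_ifs with hf
    · have : N v hist ≤ n * m := by
        calc N v hist ≤ ∑ _k : Fin n, ∑ _i : Fin m, (1 : ℝ) :=
              Finset.sum_le_sum fun k _ => Finset.sum_le_sum fun i _ =>
                mistakeProb_le_one true hΔ0 hΔ _ _ _ _
          _ = n * m := by simp
      nlinarith
    · have : N v hist ≤ n * m / 10 := by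
        by_contra! hlt
        refine hf (fails_of_not_isEpsOptimal_finalOutput alg _ _ _ _ _
          (not_isEpsOptimal_hardMDP hm hΔ0 hΔ v _ (hε.trans_le ?_)))
        exact mul_le_mul_of_nonneg_left hlt.le (by linarith)
      nlinarith
  have hsum := hlow.trans (Finset.sum_le_sum fun v _ => hup v)
  rw [Finset.sum_add_distrib, ← Finset.mul_sum, Finset.sum_const, Finset.card_univ,
    nsmul_eq_mul] at hsum
  have hcard : (0 : ℝ) ≤ Fintype.card (Fin (n + 1) → Fin m → Bool) := Nat.cast_nonneg _
  refine le_of_mul_le_mul_left ?_ (by positivity : (0 : ℝ) < 9 * (n * m) / 10)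
  nlinarith [mul_nonneg hnm.le hcard]

end Failure

section Measurability

variable {P H K : ℕ} {S A : Type} [Fintype A]

theorem measurable_policy_apply (h : Fin H) (x : S) (a : A) :
    Measurable fun π : Policy H S A => (π h x).1 a :=
  (measurable_pi_apply a).comp
    (measurable_subtype_coe.comp ((measurable_pi_apply x).comp (measurable_pi_apply h)))

theorem measurableSet_stopsAt (alg : ParallelAlgorithm.{u} P H S A) (hist : History P H S A K)
    (k : ℕ) (hk : k ≤ K) : MeasurableSet {ω | alg.StopsAt ω hist k hk} := by
  have hhalt : ∀ j (hist' : History P H S A j), Measurable fun ω => alg.halt j ω hist' :=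
    fun j hist' => measurableSet_setOfPred.1 (alg.measurableSet_halt j hist')
  exact measurableSet_setOfPred.2 ((hhalt k _).and
    (Measurable.forall fun j => Measurable.forall fun _ => (hhalt j _).not))

variable {D : ℕ} [Fintype S] {φ : S → A → EuclideanSpace ℝ (Fin D)}

theorem measurable_trajProb (M : LinearMDP H φ) (s : S) (t : Trajectory H S A) :
    Measurable fun π : Policy H S A => M.trajProb s π t :=
  (Finset.measurable_prod _ fun h _ =>
    (measurable_policy_apply h (t.1 h.castSucc) (t.2 h)).mul_const _).const_mul _

theorem measurable_value (M : LinearMDP H φ) (s : S) :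
    Measurable fun π : Policy H S A => M.value s π :=
  Finset.measurable_sum _ fun t _ => (measurable_trajProb M s t).mul_const _

theorem measurable_histProb (alg : ParallelAlgorithm.{u} P H S A) (M : LinearMDP H φ) (s : S)
    (hist : History P H S A K) : Measurable fun ω => alg.histProb M s ω hist :=
  Finset.measurable_prod _ fun _ _ => Finset.measurable_prod _ fun p _ =>
    (measurable_trajProb M s _).comp (alg.measurable_explore _ _ p)

theorem measurableSet_fails (alg : ParallelAlgorithm.{u} P H S A) (M : LinearMDP H φ) (s : S)
    (ε : ℝ) (hist : History P H S A K) : MeasurableSet {ω | alg.Fails M s ε ω hist} := by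
  have measurable_stops : ∀ k (hk : k ≤ K), Measurable fun ω => alg.StopsAt ω hist k hk :=
    fun k hk => measurableSet_setOfPred.1 (measurableSet_stopsAt alg hist k hk)
  have hopt : ∀ k (hk : k ≤ K),
      Measurable fun ω => M.IsEpsOptimal s ε (alg.output k ω (hist.truncate hk)) :=
    fun k hk => measurableSet_setOfPred.1 (measurableSet_le
      (((measurable_value M s).comp (alg.measurable_output k _)).const_sub _) measurable_const)
  exact measurableSet_setOfPred.2 <|
    (Measurable.forall fun k => Measurable.forall fun hk => (measurable_stops k hk).not).or
      (Measurable.exists fun k => Measurable.exists fun hk => (measurable_stops k hk).and (hopt k hk).not)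

open Classical in
theorem measurable_sum_fails (alg : ParallelAlgorithm.{u} P H S A) (M : LinearMDP H φ) (s : S)
    (ε : ℝ) : Measurable fun ω =>
      ∑ hist : History P H S A K with alg.Fails M s ε ω hist, alg.histProb M s ω hist := by
  simp only [Finset.sum_filter]
  exact Finset.measurable_sum _ fun hist _ =>
    Measurable.ite (measurableSet_fails alg M s ε hist) (measurable_histProb alg M s hist)
      measurable_const

end Measurability

/-- The seed is drawn independently of the hidden parameter, so the average over the parameter may
be taken inside the integral over the seed. -/
theorem exists_le_failureProb {m n P K : ℕ}
    (alg : ParallelAlgorithm.{u} P (n + 1) Bool (Fin m → Bool))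
    (hm : 0 < m) (hn : 0 < n) {Δ ε : ℝ} (hΔ0 : 0 ≤ Δ) (hΔ : m * Δ ≤ 1 / 20)
    (hT : 8 * Δ ^ 2 * (K * P : ℕ) ≤ 1 / 50) (hε : ε < 2 * Δ * (n * m / 10)) :
    ∃ v, 0.1 ≤ alg.failureProb (hardMDP hm hΔ0 hΔ v) true ε K := by
  classical
  have hint : ∀ v, Integrable (fun ω =>
      ∑ hist : History P (n + 1) Bool (Fin m → Bool) K with
        alg.Fails (hardMDP hm hΔ0 hΔ v) true ε ω hist,
        alg.histProb (hardMDP hm hΔ0 hΔ v) true ω hist) alg.seedLaw := by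
    intro v
    refine Integrable.of_bound (measurable_sum_fails alg _ _ _).aestronglyMeasurable 1
      (Filter.Eventually.of_forall fun ω => ?_)
    rw [Real.norm_of_nonneg (Finset.sum_nonneg fun hist _ => histProb_nonneg alg hm hΔ0 hΔ v _ ω _),
      ← sum_histProb (K := K) alg hm hΔ0 hΔ v true ω]
    exact Finset.sum_le_sum_of_subset_of_nonneg (Finset.filter_subset _ _)
      fun hist _ _ => histProb_nonneg alg hm hΔ0 hΔ v _ ω _
  have hsum : ∑ _v : Fin (n + 1) → Fin m → Bool, (0.1 : ℝ) ≤
      ∑ v, alg.failureProb (hardMDP hm hΔ0 hΔ v) true ε K := by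
    simp only [ParallelAlgorithm.failureProb]
    rw [← integral_finsetSum _ fun v _ => by convert hint v]
    have hle := integral_mono (μ := alg.seedLaw) (integrable_const _)
      (integrable_finsetSum Finset.univ fun v _ => hint v)
      (fun ω => card_le_sum_fails (K := K) alg hm hn hΔ0 hΔ hT hε ω)
    rw [integral_const, probReal_univ, one_smul] at hle
    rw [Finset.sum_const, Finset.card_univ, nsmul_eq_mul, mul_comm]
    convert hle
  obtain ⟨v, -, hv⟩ := Finset.exists_le_of_sum_le Finset.univ_nonempty hsum
  exact ⟨v, hv⟩

theorem theorem4 :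
    ∃ c : ℝ, 0 < c ∧
      ∀ (d H P K : ℕ) (ε : ℝ), 1 < d → 2 ≤ H → 0 < P → d ^ 2 ≤ K * P → 0 < ε →
        ¬ (c * ((d : ℝ) * H / ε) ^ 2 ≤ (K : ℝ) * P) →
        ∃ (S A : Type) (_ : Fintype S) (_ : Fintype A) (_ : Nonempty A)
          (φ : S → A → EuclideanSpace ℝ (Fin (d + 1))) (r : Fin H → S → A → ℝ) (s₀ : S),
          ∀ alg : ParallelAlgorithm.{u} P H S A,
            ∃ M : LinearMDP H φ, (∀ h x a, M.reward h x a = r h x a) ∧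
              0.1 ≤ alg.failureProb M s₀ ε K := by
  -- With bias `Δ = 1 / (20 √T)`, `T = K P`, the gap `2 Δ n m / 10` is at least
  -- `d H / (400 √T)`, because `n ≥ H / 2` and `m ≥ d / 2`.
  refine ⟨(1 / 400) ^ 2, by norm_num, ?_⟩
  intro d H P K ε hd hH hP hdKP hε hlt
  obtain ⟨m, rfl⟩ : ∃ m, d = m + 1 := ⟨d - 1, by omega⟩
  obtain ⟨n, rfl⟩ : ∃ n, H = n + 1 := ⟨H - 1, by omega⟩
  have hm : 0 < m := by omega
  have hn : 0 < n := by omega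
  have hm1 : (1 : ℝ) ≤ m := by exact_mod_cast hm
  have hn1 : (1 : ℝ) ≤ n := by exact_mod_cast hn
  rw [not_le] at hlt
  set T : ℝ := (K : ℝ) * P with hTdef
  have hdT : ((m : ℝ) + 1) ^ 2 ≤ T := by rw [hTdef]; exact_mod_cast hdKP
  have hTpos : 0 < T := by nlinarith
  have hs : 0 < Real.sqrt T := Real.sqrt_pos.2 hTpos
  have hsq : Real.sqrt T ^ 2 = T := Real.sq_sqrt hTpos.le
  have hms : (m : ℝ) + 1 ≤ Real.sqrt T := Real.le_sqrt_of_sq_le hdT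
  have hΔ0 : 0 ≤ 1 / (20 * Real.sqrt T) := by positivity
  have hΔ : (m : ℝ) * (1 / (20 * Real.sqrt T)) ≤ 1 / 20 := by
    rw [mul_one_div, div_le_div_iff₀ (by positivity) (by norm_num)]
    linarith
  have hT : 8 * (1 / (20 * Real.sqrt T)) ^ 2 * (K * P : ℕ) ≤ 1 / 50 := by
    push_cast
    rw [← hTdef, div_pow, mul_pow, hsq]
    refine le_of_eq ?_
    field_simp
    norm_num
  have hεs : ε * Real.sqrt T < 1 / 400 * (((m : ℝ) + 1) * (n + 1)) := by
    refine lt_of_pow_lt_pow_left₀ 2 (by positivity) ?_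
    push_cast at hlt
    rw [mul_pow, hsq, mul_pow]
    rw [div_pow _ ε, mul_div_assoc', lt_div_iff₀ (by positivity)] at hlt
    linarith
  have hεΔ : ε < 2 * (1 / (20 * Real.sqrt T)) * (n * m / 10) := by
    have : 2 * (1 / (20 * Real.sqrt T)) * ((n : ℝ) * m / 10) =
        (1 / 100 * (n * m)) / Real.sqrt T := by field_simp; norm_num
    rw [this, lt_div_iff₀ hs]
    nlinarith
  refine ⟨Bool, Fin m → Bool, inferInstance, inferInstance, inferInstance, hardFeature m,
    fun _ x _ => if x then 1 else 0, true, fun alg => ?_⟩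
  obtain ⟨v, hv⟩ := exists_le_failureProb alg hm hn hΔ0 hΔ hT hεΔ
  exact ⟨hardMDP hm hΔ0 hΔ v, fun h x a => reward_hardMDP hm hΔ0 hΔ v h x a, hv⟩
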